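/- Define words over $\{0,1,2\}$ by $w_1=01$ and $w_i=w_{i-1}w_{i-1}\,(w_{i-2}w_{i-3}\cdots w_1)\,2$ for $i\ge 2$ (for $i=2$ the bracketed product is empty). Each $w_i$ is a prefix of $w_{i+1}$; let $w$ be the infinite limit word, with letters $w[0],w[1],\dots$. Let $a_0=1$ and $a_i=|w_i|$ for $i\ge1$. If $n$ is a positive integer with $a_j\le n<a_{j+1}$, its $(a_i)$-representation is the digit string $d_jd_{j-1}\cdots d_0$ of nonnegative integers with $n=\sum_{i=0}^{j}d_ia_i$ and $\sum_{i=0}^{j} d_i$ as small as possible; it ends in a two-block if its last digits are $2\,1^m\,0$ for some $m\ge0$. Let $T=\{a_i-1: i\ge 1\}$, and let $I$ consist of $1$ and all positive integers whose $(a_i)$-representation ends in a two-block. For a set $S$ of positive integers, the Nim sequence of $S$ is the sequence $(\mathrm{SG}_S(n))_{n\ge0}$ given by $\mathrm{SG}_S(n)=\operatorname{mex}\{\mathrm{SG}_S(n-s): s\in S,\ s\le n\}$, where $\operatorname{mex}$ is the least nonnegative integer not in the set. **Theorem.** One has $a_i=F(2i+1)$ for all $i\ge0$, where $F(1)=F(2)=1$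 and $F(n)=F(n-1)+F(n-2)$, and $T\subseteq I$. For every set $S$ with $T\subseteq S\subseteq I$: 1. $w$ is the Nim sequence of $S$; 2. for every $i\ge0$, the Nim sequence of $S_i=\{s\in S: s<a_i\}$ is the purely periodic sequence $(w[0]w[1]\cdots w[a_i-1])^\omega$. In particular, there is a subtraction set of positive natural density, namely $I$, whose Nim sequence is ternary (its set of values is exactly $\{0,1,2\}$) and aperiodic (not eventually periodic). -/

import Mathlib

namespace SubtractionGame

/-! ### Sprague-Grundy values of subtraction games -/

/-- The minimal excluded nonnegative integer of `A`. It is only applied to finite sets. -/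
noncomputable def mex (A : Set ℕ) : ℕ := sInf Aᶜ

/-- The Sprague-Grundy function of the subtraction game with subtraction set `S`: from position `n`
the legal moves are to the positions `n - s` with `s ∈ S` and `0 < s ≤ n`. As a function of `n`
this is the Nim sequence of `S`. -/
noncomputable def SG (S : Set ℕ) (n : ℕ) : ℕ :=
  mex {v | ∃ s, ∃ _h : s ∈ S ∧ 0 < s ∧ s ≤ n, SG S (n - s) = v}
termination_by n
decreasing_by omega

/-- A sequence is eventually periodic if it is periodic from some index on. -/
def EventuallyPeriodic (f : ℕ → ℕ) : Prop :=
  ∃ p, 0 < p ∧ ∃ N, ∀ n, N ≤ n → f (n + p) = f n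

/-- The set `A` has a natural density among the positive integers, and this density is positive. -/
def HasPositiveDensity (A : Set ℕ) : Prop :=
  ∃ δ : ℝ, 0 < δ ∧
    Filter.Tendsto (fun N : ℕ => ((A ∩ Set.Icc 1 N).ncard : ℝ) / (N : ℝ)) Filter.atTop (nhds δ)

/-! ### The ternary words -/

/-- The words `w_1 = 01` and `w_i = w_{i-1} w_{i-1} (w_{i-2} w_{i-3} ⋯ w_1) 2` for `i ≥ 2`.
The value at `0` (the empty word) is not used. -/
def word : ℕ → List ℕ
  | 0 => []
  | 1 => [0, 1]
  | i + 2 =>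
      word (i + 1) ++ word (i + 1) ++ (List.ofFn fun j : Fin i => word (i - j)).flatten ++ [2]
termination_by i => i
decreasing_by all_goals omega

/-- The infinite word `w = lim w_i`: its `n`-th letter is the one of `w_{n+1}`, which has more than
`n` letters. The lemma `word_getElem?` shows that every `w_i` is a prefix of it. -/
def limitWord (n : ℕ) : ℕ := (word (n + 1)).getD n 0

theorem word_prefix_succ (i : ℕ) : word i <+: word (i + 1) := by
  rcases i with _ | i
  · simp [word]
  · rw [word.eq_3 i, List.append_assoc, List.append_assoc]
    exact List.prefix_append _ _

theorem word_prefix {i j : ℕ} (h : i ≤ j) : word i <+: word j := by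
  induction j, h using Nat.le_induction with
  | base => exact List.prefix_rfl
  | succ k _ ih => exact ih.trans (word_prefix_succ k)

theorem lt_length_word (n : ℕ) : n < (word (n + 1)).length := by
  induction n with
  | zero => simp [word]
  | succ k ih =>
      rw [word.eq_3 k]
      simp only [List.length_append, List.length_cons, List.length_nil]
      omega

theorem word_getElem? (i n : ℕ) (h : n < (word i).length) :
    (word i)[n]? = some (limitWord n) := by
  have key : ∀ {l m : List ℕ}, l <+: m → n < l.length → l[n]? = m[n]? := by
    rintro l m ⟨t, rfl⟩ hl
    rw [List.getElem?_append_left hl]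
  have hn := lt_length_word n
  have e : (word (n + 1))[n]? = some (limitWord n) := by
    simp [limitWord, List.getD, List.getElem?_eq_getElem hn]
  rcases le_total i (n + 1) with hi | hi
  · rw [key (word_prefix hi) h, e]
  · rw [← key (word_prefix hi) hn, e]

/-- The sequence `a_0 = 1`, `a_i = |w_i|` for `i ≥ 1`. -/
def a (i : ℕ) : ℕ := if i = 0 then 1 else (word i).length

/-! ### Digital representations -/

/-- `d_j d_{j-1} ⋯ d_0` is the `b`-representation of the positive integer `n`: here
`b_j ≤ n < b_{j+1}`, and among all ways to write `n = ∑_{i ≤ j} d_i b_i` with nonnegative integers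
`d_i` the digit sum `∑ d_i` is as small as possible. Digits beyond the leading place are set
to `0`. -/
structure IsRepresentation (b : ℕ → ℕ) (n j : ℕ) (d : ℕ → ℕ) : Prop where
  index_le : b j ≤ n
  lt_index : n < b (j + 1)
  digit_eq_zero : ∀ i, j < i → d i = 0
  sum_eq : ∑ i ∈ Finset.range (j + 1), d i * b i = n
  minimal : ∀ e : ℕ → ℕ, ∑ i ∈ Finset.range (j + 1), e i * b i = n →
    ∑ i ∈ Finset.range (j + 1), d i ≤ ∑ i ∈ Finset.range (j + 1), e i

/-- The digit string `⋯ d_2 d_1 d_0` ends in a two-block `2 1^m 0` for some `m ≥ 0`. -/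
def EndsInTwoBlock (d : ℕ → ℕ) : Prop :=
  ∃ m, d (m + 1) = 2 ∧ (∀ i, 1 ≤ i → i ≤ m → d i = 1) ∧ d 0 = 0

/-! ### The minimal and the maximal subtraction set -/

/-- `T = {a_i - 1 : i ≥ 1}`; all `a_i` are positive. -/
def T : Set ℕ := {n | ∃ i, 1 ≤ i ∧ n = a i - 1}

/-- `I` consists of `1` and of all positive integers whose `(a_i)`-representation ends in a
two-block. -/
def I : Set ℕ :=
  {n | n = 1 ∨ (0 < n ∧ ∃ j d, IsRepresentation a n j d ∧ EndsInTwoBlock d)}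

end SubtractionGame

namespace SubtractionGame

/-! Up to position `a L`, the word is the coding of a finite rotation. Put q = F(2L), b = F(2L+1)
and r(n) = q n mod b. Letter n is 0, 2 or 1 according as r(n) lies in [0, b-q), [b-q, q) or [q, b).
The recursion for the words matches the first-return structure of this rotation, which is controlled
by the Fibonacci convergents (`word_tailWord_eq`).

The Nim property is then geometry on the circle. A shift by a residue in [b-q, q] moves each of the
three intervals off itself. This covers s = 1, whose residue is q, and every s with letter 2, so no
such move preserves the letter (`rotationLetter_ne_of_add`). Conversely, s = 1 leads from letter 1
to 0 and from 2 to 1. From letter 2 some move a_k - 1 reaches letter 0, because a_k has the smallest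
positive residues (`exists_rotationLetter_sub_eq_zero`).

Minimality of the digit sum forbids a few digit patterns. The residue of n is then its digit string
read with the weights F(2(j+1-k)), without reduction, and it falls in the middle interval exactly
when the string ends in a two-block. Hence I consists of 1 and the positions of the letter 2
(`mem_I_iff`).

Aperiodicity holds because every p divides some a_t - 1 in T. The density of I is 2/φ - 1, by
counting wraps of the rotation. -/

/-! ### Fibonacci convergents and the linear form F(2L) N - F(2L+1) M -/

theorem fib_convergent_identities (k e : ℕ) :
    (Nat.fib (2 * (k + 1 + e)) : ℤ) * Nat.fib (2 * k + 1) -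
        Nat.fib (2 * (k + 1 + e) + 1) * Nat.fib (2 * k) = Nat.fib (2 * e + 2) ∧
    (Nat.fib (2 * (k + 1 + e)) : ℤ) * Nat.fib (2 * k + 2) -
        Nat.fib (2 * (k + 1 + e) + 1) * Nat.fib (2 * k + 1) = -Nat.fib (2 * e + 1) := by
  induction k generalizing e with
  | zero =>
      have h : Nat.fib (2 * (0 + 1 + e) + 1) = Nat.fib (2 * e + 1) + Nat.fib (2 * e + 2) := by
        rw [show 2 * (0 + 1 + e) + 1 = 2 * e + 1 + 2 by ring, Nat.fib_add_two]
      have h2 : 2 * (0 + 1 + e) = 2 * e + 2 := by ring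
      rw [h, h2]
      simp
  | succ k ih =>
      obtain ⟨h1, h2⟩ := ih (e + 1)
      rw [show k + 1 + (e + 1) = k + 1 + 1 + e by ring] at h1 h2
      have f3 : Nat.fib (2 * (k + 1) + 1) = Nat.fib (2 * k + 1) + Nat.fib (2 * k + 2) := by
        rw [show 2 * (k + 1) + 1 = 2 * k + 1 + 2 by ring, Nat.fib_add_two]
      have f4 : Nat.fib (2 * (k + 1) + 2) = Nat.fib (2 * k + 2) + Nat.fib (2 * (k + 1) + 1) := by
        rw [Nat.fib_add_two]; ring_nf
      have g4 : Nat.fib (2 * (e + 1) + 2) = Nat.fib (2 * e + 2) + Nat.fib (2 * (e + 1) + 1) := by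
        rw [Nat.fib_add_two]; ring_nf
      have g3 : Nat.fib (2 * (e + 1) + 1) = Nat.fib (2 * e + 1) + Nat.fib (2 * e + 2) := by
        rw [show 2 * (e + 1) + 1 = 2 * e + 1 + 2 by ring, Nat.fib_add_two]
      rw [show 2 * (k + 1) = 2 * k + 2 by ring] at *
      rw [f4, f3]
      rw [g4, g3] at h1
      rw [g3] at h2
      have f2 : (Nat.fib (2 * k + 2) : ℤ) = Nat.fib (2 * k) + Nat.fib (2 * k + 1) := by
        exact_mod_cast Nat.fib_add_two
      push_cast at *
      constructor
      · linear_combination h1 + h2 - (Nat.fib (2 * (k + 1 + 1 + e) + 1) : ℤ) * f2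
      · linear_combination h1 + 2 * h2 - (Nat.fib (2 * (k + 1 + 1 + e) + 1) : ℤ) * f2

/-- By Cassini, two consecutive convergents form a basis of ℤ². The linear form takes values of
opposite sign on them, so a small value forces x and y not to have opposite signs, which pushes N
out of a given range. All best-approximation arguments below are this case split on the sign of y.
-/
theorem exists_fib_coordinates (k e : ℕ) (N M : ℤ) :
    ∃ x y : ℤ, N = x * Nat.fib (2 * k + 1) + y * Nat.fib (2 * k + 2) ∧
      (Nat.fib (2 * (k + 1 + e)) : ℤ) * N - Nat.fib (2 * (k + 1 + e) + 1) * M =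
        x * Nat.fib (2 * e + 2) - y * Nat.fib (2 * e + 1) := by
  obtain ⟨h1, h2⟩ := fib_convergent_identities k e
  have cassini : (Nat.fib (2 * k + 1) : ℤ) * Nat.fib (2 * k + 1) -
      Nat.fib (2 * k + 2) * Nat.fib (2 * k) = 1 := by
    have h := (fib_convergent_identities k 0).1
    have f3 : Nat.fib (2 * (k + 1 + 0) + 1) = Nat.fib (2 * k + 1) + Nat.fib (2 * k + 2) := by
      rw [show 2 * (k + 1 + 0) + 1 = 2 * k + 1 + 2 by ring, Nat.fib_add_two]
    have f2 : Nat.fib (2 * k + 2) = Nat.fib (2 * k) + Nat.fib (2 * k + 1) := Nat.fib_add_two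
    rw [f3, show 2 * (k + 1 + 0) = 2 * k + 2 by ring, f2] at h
    rw [f2]
    push_cast at *
    simp only [Nat.fib_two, Nat.cast_one] at h
    linarith
  have hN : N = (Nat.fib (2 * k + 1) * N - Nat.fib (2 * k + 2) * M) * Nat.fib (2 * k + 1) +
      (Nat.fib (2 * k + 1) * M - Nat.fib (2 * k) * N) * Nat.fib (2 * k + 2) := by
    linear_combination (-N) * cassini
  have hM : M = (Nat.fib (2 * k + 1) * N - Nat.fib (2 * k + 2) * M) * Nat.fib (2 * k) +
      (Nat.fib (2 * k + 1) * M - Nat.fib (2 * k) * N) * Nat.fib (2 * k + 1) := by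
    linear_combination (-M) * cassini
  refine ⟨_, _, hN, ?_⟩
  conv_lhs => rw [hN, hM]
  rw [← h1, ← neg_eq_iff_eq_neg.mpr h2]
  ring

/-! ### The finite rotation and its coding -/

/-- `F(2L) n` modulo `F(2L+1)`. -/
def residue (L n : ℕ) : ℕ := Nat.fib (2 * L) * n % Nat.fib (2 * L + 1)

/-- The coding of the rotation by `F(2L)` modulo `F(2L+1)` with respect to the intervals
`[0, F(2L-1))`, `[F(2L-1), F(2L))` and `[F(2L), F(2L+1))`. -/
def rotationLetter (L n : ℕ) : ℕ :=
  if residue L n + Nat.fib (2 * L) < Nat.fib (2 * L + 1) then 0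
  else if residue L n < Nat.fib (2 * L) then 2 else 1

theorem fib_odd_pos (L : ℕ) : 0 < Nat.fib (2 * L + 1) := Nat.fib_pos.mpr (by omega)

theorem fib_two_mul_succ (l : ℕ) :
    Nat.fib (2 * (l + 1)) = Nat.fib (2 * l) + Nat.fib (2 * l + 1) := by
  rw [show 2 * (l + 1) = 2 * l + 2 by ring, Nat.fib_add_two]

theorem fib_two_mul_succ_add_one (l : ℕ) :
    Nat.fib (2 * (l + 1) + 1) = Nat.fib (2 * l) + 2 * Nat.fib (2 * l + 1) := by
  rw [show 2 * (l + 1) + 1 = 2 * l + 1 + 2 by ring, Nat.fib_add_two,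
    show 2 * l + 1 + 1 = 2 * l + 2 by ring, Nat.fib_add_two]
  ring

theorem fib_two_mul_le (l : ℕ) : Nat.fib (2 * l) ≤ Nat.fib (2 * l + 1) := Nat.fib_le_fib_succ

theorem residue_lt (L n : ℕ) : residue L n < Nat.fib (2 * L + 1) := Nat.mod_lt _ (fib_odd_pos L)

theorem exists_residue (L n : ℕ) :
    ∃ M : ℤ, (Nat.fib (2 * L) : ℤ) * n = Nat.fib (2 * L + 1) * M + residue L n := by
  refine ⟨(Nat.fib (2 * L) * n / Nat.fib (2 * L + 1) : ℕ), ?_⟩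
  unfold residue
  exact_mod_cast (Nat.div_add_mod _ _).symm

theorem residue_eq {L n r : ℕ} {M : ℤ}
    (h : (Nat.fib (2 * L) : ℤ) * n = Nat.fib (2 * L + 1) * M + r)
    (hr : r < Nat.fib (2 * L + 1)) : residue L n = r := by
  have h1 : ((Nat.fib (2 * L) * n : ℕ) : ℤ) % (Nat.fib (2 * L + 1) : ℕ) = (r : ℕ) := by
    push_cast
    rw [h, Int.mul_add_emod_self_left]
    exact Int.emod_eq_of_lt (by positivity) (by exact_mod_cast hr)
  unfold residue
  exact_mod_cast h1

theorem residue_mod (L n : ℕ) : residue L (n % Nat.fib (2 * L + 1)) = residue L n := by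
  simp [residue, Nat.mul_mod]

theorem rotationLetter_mod (L n : ℕ) :
    rotationLetter L (n % Nat.fib (2 * L + 1)) = rotationLetter L n := by
  simp [rotationLetter, residue_mod]

/-- The shift raises the residue by only F(2e+2). The interval endpoints are themselves orbit
points, of indices 0, -1 and 1, so crossing one would give a too good approximation with small N. -/
theorem rotationLetter_add_of_lt {i e n : ℕ} (hi : 1 ≤ i) (hn : n < Nat.fib (2 * i + 1)) :
    rotationLetter (i + 1 + e) (n + Nat.fib (2 * i + 1)) = rotationLetter (i + 1 + e) n := by
  have hlt : (Nat.fib (2 * i + 1) : ℤ) < Nat.fib (2 * i + 2) := by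
    exact_mod_cast Nat.fib_lt_fib_succ (by omega)
  have h2 : (2 : ℤ) ≤ Nat.fib (2 * i + 1) := by
    exact_mod_cast (Nat.fib_mono (show 3 ≤ 2 * i + 1 by omega))
  have far : ∀ N M : ℤ, -Nat.fib (2 * i + 1) ≤ N → N ≤ 1 →
      ¬ (0 < (Nat.fib (2 * (i + 1 + e)) : ℤ) * N - Nat.fib (2 * (i + 1 + e) + 1) * M ∧
      (Nat.fib (2 * (i + 1 + e)) : ℤ) * N - Nat.fib (2 * (i + 1 + e) + 1) * M ≤
        Nat.fib (2 * e + 2)) := by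
    rintro N M hN hN' ⟨hz, hz'⟩
    obtain ⟨x, y, hxy, hxy'⟩ := exists_fib_coordinates i e N M
    rw [hxy'] at hz hz'
    have g : (0 : ℤ) < Nat.fib (2 * e + 2) := by exact_mod_cast Nat.fib_pos.mpr (by omega)
    have g' : (0 : ℤ) < Nat.fib (2 * e + 1) := by exact_mod_cast Nat.fib_pos.mpr (by omega)
    rcases lt_trichotomy y 0 with hy | hy | hy
    · have : x < 1 := by
        by_contra! hx
        nlinarith
      nlinarith
    · subst hy
      have : 0 < x := by
        by_contra! hx
        nlinarith
      nlinarith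
    · have : 0 < x := by
        by_contra! hx
        nlinarith
      nlinarith
  have hg := (fib_convergent_identities i e).1
  obtain ⟨M, hM⟩ := exists_residue (i + 1 + e) n
  have hr := residue_lt (i + 1 + e) n
  -- One instance for each endpoint: b (that is, 0), b-q and q, as seen from r(n).
  have far0 := far (-n) (-M - 1) (by omega) (by omega)
  have far1 := far (-n - 1) (-M - 1) (by omega) (by omega)
  have far2 := far (1 - n) (-M) (by omega) (by omega)
  have e0 : (Nat.fib (2 * (i + 1 + e)) : ℤ) * (-n) - Nat.fib (2 * (i + 1 + e) + 1) * (-M - 1) =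
      Nat.fib (2 * (i + 1 + e) + 1) - residue (i + 1 + e) n := by linear_combination -hM
  have e1 : (Nat.fib (2 * (i + 1 + e)) : ℤ) * (-n - 1) -
      Nat.fib (2 * (i + 1 + e) + 1) * (-M - 1) = Nat.fib (2 * (i + 1 + e) + 1) -
      Nat.fib (2 * (i + 1 + e)) - residue (i + 1 + e) n := by linear_combination -hM
  have e2 : (Nat.fib (2 * (i + 1 + e)) : ℤ) * (1 - n) - Nat.fib (2 * (i + 1 + e) + 1) * (-M) =
      Nat.fib (2 * (i + 1 + e)) - residue (i + 1 + e) n := by linear_combination -hM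
  rw [e0] at far0
  rw [e1] at far1
  rw [e2] at far2
  have key : residue (i + 1 + e) (n + Nat.fib (2 * i + 1)) =
      residue (i + 1 + e) n + Nat.fib (2 * e + 2) := by
    apply residue_eq (M := M + Nat.fib (2 * i))
    · push_cast
      linear_combination hM + hg
    · omega
  unfold rotationLetter
  rw [key]
  split_ifs <;> omega

/-- The two positions differ by F(2(i+2)+2), a convergent on the other side, which lowers the
residue by F(2e+1). Again no endpoint is close enough to be crossed. -/
theorem rotationLetter_add_two_mul {i e m : ℕ} (hm : m < Nat.fib (2 * (i + 2))) :
    rotationLetter (i + 2 + 1 + e) (m + 2 * Nat.fib (2 * (i + 2) + 1)) =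
      rotationLetter (i + 2 + 1 + e) (m + Nat.fib (2 * (i + 1) + 1)) := by
  have f1 := fib_two_mul_succ (i + 1)
  have f2 := fib_two_mul_succ_add_one (i + 1)
  have f3 := fib_two_mul_succ (i + 2)
  have f4 : (2 : ℤ) ≤ Nat.fib (2 * (i + 1) + 1) := by
    exact_mod_cast (Nat.fib_mono (show 3 ≤ 2 * (i + 1) + 1 by omega))
  simp only [add_assoc, Nat.reduceAdd] at f1 f2 f3
  have far : ∀ N M : ℤ, 1 ≤ N → N ≤ Nat.fib (2 * (i + 2) + 1) →
      ¬ (0 ≤ (Nat.fib (2 * (i + 2 + 1 + e)) : ℤ) * N - Nat.fib (2 * (i + 2 + 1 + e) + 1) * M ∧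
      (Nat.fib (2 * (i + 2 + 1 + e)) : ℤ) * N - Nat.fib (2 * (i + 2 + 1 + e) + 1) * M <
        Nat.fib (2 * e + 1)) := by
    rintro N M hN hN' ⟨hz, hz'⟩
    obtain ⟨x, y, hxy, hxy'⟩ := exists_fib_coordinates (i + 2) e N M
    rw [hxy'] at hz hz'
    have g : (Nat.fib (2 * e + 1) : ℤ) ≤ Nat.fib (2 * e + 2) := by
      exact_mod_cast Nat.fib_le_fib_succ
    have g' : (0 : ℤ) < Nat.fib (2 * e + 1) := by exact_mod_cast Nat.fib_pos.mpr (by omega)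
    have g'' : (0 : ℤ) < Nat.fib (2 * (i + 2) + 2) := by
      exact_mod_cast Nat.fib_pos.mpr (by omega)
    rcases lt_trichotomy y 0 with hy | hy | hy
    · have : x < 0 := by
        by_contra! hx
        nlinarith
      nlinarith
    · subst hy
      have : 0 < x := by
        by_contra! hx
        nlinarith
      nlinarith
    · have : 0 < x := by
        by_contra! hx
        nlinarith
      nlinarith
  obtain ⟨-, hg⟩ := fib_convergent_identities (i + 2) e
  set u := m + Nat.fib (2 * (i + 1) + 1) with hu
  have hu' : m + 2 * Nat.fib (2 * (i + 2) + 1) = u + Nat.fib (2 * (i + 2) + 2) := by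
    have : Nat.fib (2 * (i + 2) + 2) = Nat.fib (2 * (i + 2)) + Nat.fib (2 * (i + 2) + 1) :=
      Nat.fib_add_two
    omega
  rw [hu']
  obtain ⟨M, hM⟩ := exists_residue (i + 2 + 1 + e) u
  have hr := residue_lt (i + 2 + 1 + e) u
  have far0 := far u M (by omega) (by omega)
  have far1 := far (u + 1) (M + 1) (by omega) (by omega)
  have far2 := far (u - 1) M (by omega) (by omega)
  have e0 : (Nat.fib (2 * (i + 2 + 1 + e)) : ℤ) * u - Nat.fib (2 * (i + 2 + 1 + e) + 1) * M =
      residue (i + 2 + 1 + e) u := by linear_combination hM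
  have e1 : (Nat.fib (2 * (i + 2 + 1 + e)) : ℤ) * (u + 1) -
      Nat.fib (2 * (i + 2 + 1 + e) + 1) * (M + 1) = residue (i + 2 + 1 + e) u -
      (Nat.fib (2 * (i + 2 + 1 + e) + 1) - Nat.fib (2 * (i + 2 + 1 + e))) := by
    linear_combination hM
  have e2 : (Nat.fib (2 * (i + 2 + 1 + e)) : ℤ) * (u - 1) -
      Nat.fib (2 * (i + 2 + 1 + e) + 1) * M =
      residue (i + 2 + 1 + e) u - Nat.fib (2 * (i + 2 + 1 + e)) := by linear_combination hM
  rw [e0] at far0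
  rw [e1] at far1
  rw [e2] at far2
  obtain ⟨t, ht⟩ : ∃ t, residue (i + 2 + 1 + e) u = t + Nat.fib (2 * e + 1) :=
    ⟨_, (Nat.sub_add_cancel (by omega)).symm⟩
  have key : residue (i + 2 + 1 + e) (u + Nat.fib (2 * (i + 2) + 2)) = t := by
    apply residue_eq (M := M + Nat.fib (2 * (i + 2) + 1))
    · rw [ht] at hM
      push_cast at *
      linear_combination hM + hg
    · omega
  unfold rotationLetter
  rw [key]
  split_ifs <;> omega

theorem residue_mul_add {L n : ℕ} {M r : ℕ}
    (h : Nat.fib (2 * L) * n = Nat.fib (2 * L + 1) * M + r)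
    (hr : r < Nat.fib (2 * L + 1)) : residue L n = r :=
  residue_eq (M := M) (by exact_mod_cast h) hr

theorem rotationLetter_zero (L : ℕ) : rotationLetter L 0 = 0 := by
  have : Nat.fib (2 * L) < Nat.fib (2 * L + 1) := by
    rcases L with _ | L
    · simp
    · exact Nat.fib_lt_fib_succ (by omega)
  simp [rotationLetter, residue, this]

theorem rotationLetter_one (l : ℕ) : rotationLetter (l + 1) 1 = 1 := by
  have h1 := fib_two_mul_succ l
  have h2 := fib_two_mul_succ_add_one l
  have h3 := fib_odd_pos l
  have h4 := fib_two_mul_le l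
  have : residue (l + 1) 1 = Nat.fib (2 * (l + 1)) := residue_mul_add (M := 0) (by ring) (by omega)
  unfold rotationLetter
  rw [this]
  split_ifs <;> omega

theorem rotationLetter_two_three_four (l : ℕ) : rotationLetter (l + 2) 2 = 0 ∧
    rotationLetter (l + 2) 3 = 1 ∧ rotationLetter (l + 2) 4 = 2 := by
  have h1 := fib_two_mul_succ l
  have h2 := fib_two_mul_succ_add_one l
  have h1' := fib_two_mul_succ (l + 1)
  have h2' := fib_two_mul_succ_add_one (l + 1)
  have h3 := fib_odd_pos l
  have h4 := fib_two_mul_le l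
  simp only [add_assoc, Nat.reduceAdd] at h1' h2'
  have r2 : residue (l + 2) 2 = Nat.fib (2 * (l + 1)) :=
    residue_mul_add (M := 1) (by omega) (by omega)
  have r3 : residue (l + 2) 3 = 2 * Nat.fib (2 * (l + 1)) + Nat.fib (2 * (l + 1) + 1) :=
    residue_mul_add (M := 1) (by omega) (by omega)
  have r4 : residue (l + 2) 4 = 2 * Nat.fib (2 * (l + 1)) :=
    residue_mul_add (M := 2) (by omega) (by omega)
  unfold rotationLetter
  rw [r2, r3, r4]
  refine ⟨?_, ?_, ?_⟩ <;> split_ifs <;> omega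

/-! ### The words as rotation codings -/

/-- The word `w_i w_{i-1} ⋯ w_1 2`. -/
def tailWord (i : ℕ) : List ℕ := (List.ofFn fun j : Fin i => word (i - j)).flatten ++ [2]

theorem tailWord_zero : tailWord 0 = [2] := by simp [tailWord]

theorem tailWord_succ (i : ℕ) : tailWord (i + 1) = word (i + 1) ++ tailWord i := by
  simp [tailWord, List.ofFn_succ]

theorem word_one : word 1 = [0, 1] := by rw [word]

theorem word_add_two (i : ℕ) : word (i + 2) = word (i + 1) ++ tailWord (i + 1) := by
  rw [word, tailWord_succ, tailWord]
  simp only [List.append_assoc]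

theorem range_map_add {α : Type*} (f : ℕ → α) (m n : ℕ) : (List.range (m + n)).map f =
    (List.range m).map f ++ (List.range n).map fun k => f (m + k) := by
  rw [List.range_add, List.map_append, List.map_map]
  rfl

/-- The tail word is the stretch following w_{i+1} inside w_{i+2}, which closes a joint induction.
The quantifier over e is essential: the step uses the hypotheses at a higher level. -/
theorem word_tailWord_eq (i : ℕ) :
    (∀ e, word (i + 1) =
      (List.range (Nat.fib (2 * (i + 1) + 1))).map (rotationLetter (i + 1 + e))) ∧
    ∀ e, tailWord (i + 1) = (List.range (Nat.fib (2 * (i + 2)))).map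
      fun n => rotationLetter (i + 2 + e) (n + Nat.fib (2 * (i + 1) + 1)) := by
  induction i with
  | zero =>
      constructor
      · intro e
        have h := rotationLetter_one e
        rw [add_comm] at h
        simp [word_one, List.range_succ, Nat.fib_add_two, rotationLetter_zero, h]
      · intro e
        obtain ⟨h2, h3, h4⟩ := rotationLetter_two_three_four e
        rw [add_comm] at h2 h3 h4
        simp [tailWord_succ, tailWord_zero, word_one, List.range_succ, Nat.fib_add_two, h2, h3, h4]
  | succ i ih =>
      obtain ⟨hw, ht⟩ := ih
      have hw' : ∀ e, word (i + 1 + 1) =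
          (List.range (Nat.fib (2 * (i + 1 + 1) + 1))).map (rotationLetter (i + 1 + 1 + e)) := by
        intro e
        rw [word_add_two, hw (e + 1), ht e,
          show Nat.fib (2 * (i + 1 + 1) + 1) =
            Nat.fib (2 * (i + 1) + 1) + Nat.fib (2 * (i + 2)) by
              rw [show 2 * (i + 1 + 1) + 1 = 2 * (i + 1) + 1 + 2 by ring, Nat.fib_add_two]
              ring_nf,
          range_map_add, show i + 1 + (e + 1) = i + 2 + e by ring]
        congr 1
        exact List.map_congr_left fun n _ => by rw [add_comm n]
      refine ⟨hw', fun e => ?_⟩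
      rw [tailWord_succ, hw' (e + 1), ht (e + 1), fib_two_mul_succ (i + 2),
        add_comm (Nat.fib (2 * (i + 2))), range_map_add,
        show i + 1 + 1 + (e + 1) = i + 1 + 1 + 1 + e by ring,
        show i + 1 + 2 + e = i + 1 + 1 + 1 + e by ring]
      congr 1
      · refine List.map_congr_left fun n hn => ?_
        exact (rotationLetter_add_of_lt (by omega) (List.mem_range.mp hn)).symm
      · refine List.map_congr_left fun n hn => ?_
        rw [show i + 1 + 1 + 1 + e = i + 2 + 1 + e by ring,
          ← rotationLetter_add_two_mul (List.mem_range.mp hn)]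
        congr 1
        ring_nf

theorem a_eq_fib (i : ℕ) : a i = Nat.fib (2 * i + 1) := by
  rcases i with _ | i
  · simp [a]
  · rw [a, if_neg (by omega), (word_tailWord_eq i).1 0]
    simp

theorem limitWord_eq_rotationLetter {i n : ℕ} (h : n < a i) :
    limitWord n = rotationLetter i n := by
  rcases i with _ | i
  · obtain rfl : n = 0 := by simpa [a] using h
    rw [rotationLetter_zero]
    simp [limitWord, word_one]
  · rw [a, if_neg (by omega)] at h
    have h1 := word_getElem? (i + 1) n h
    have h2 := (word_tailWord_eq i).1 0
    rw [h2] at h1 h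
    simp only [List.length_map, List.length_range] at h
    rw [List.getElem?_map, List.getElem?_range h] at h1
    simpa using h1.symm

/-! ### Moves of the game on the circle -/

theorem rotationLetter_eq_two_iff {L n : ℕ} : rotationLetter L n = 2 ↔
    Nat.fib (2 * L + 1) ≤ residue L n + Nat.fib (2 * L) ∧ residue L n < Nat.fib (2 * L) := by
  unfold rotationLetter
  split_ifs <;> simp <;> omega

theorem rotationLetter_eq_one_iff {L n : ℕ} : rotationLetter L n = 1 ↔
    Nat.fib (2 * L + 1) ≤ residue L n + Nat.fib (2 * L) ∧ Nat.fib (2 * L) ≤ residue L n := by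
  unfold rotationLetter
  split_ifs <;> simp <;> omega

/-- No interval is longer than F(2L-1), while s rotates by at least F(2L-1) in either direction. -/
theorem rotationLetter_ne_of_add {L s : ℕ} (hs : (s = 1 ∧ 1 ≤ L) ∨ rotationLetter L s = 2) (n : ℕ) :
    rotationLetter L (n + s) ≠ rotationLetter L n := by
  rcases L with _ | l
  · rcases hs with hs | hs
    · omega
    · simp [rotationLetter, residue] at hs
  have h1 := fib_two_mul_succ l
  have h2 := fib_two_mul_succ_add_one l
  have h3 := fib_odd_pos l
  have h4 := fib_two_mul_le l
  have hr := residue_lt (l + 1) n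
  have hr' := residue_lt (l + 1) (n + s)
  have hs' : Nat.fib (2 * l + 1) ≤ residue (l + 1) s ∧
      residue (l + 1) s ≤ Nat.fib (2 * (l + 1)) := by
    rcases hs with ⟨rfl, -⟩ | hs
    · have : residue (l + 1) 1 = Nat.fib (2 * (l + 1)) :=
        residue_mul_add (M := 0) (by ring) (by omega)
      omega
    · unfold rotationLetter at hs
      split_ifs at hs <;> omega
  have hadd : residue (l + 1) (n + s) = residue (l + 1) n + residue (l + 1) s ∨
      residue (l + 1) (n + s) + Nat.fib (2 * (l + 1) + 1) =
        residue (l + 1) n + residue (l + 1) s := by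
    have hs3 := residue_lt (l + 1) s
    obtain ⟨M, hM⟩ := exists_residue (l + 1) n
    obtain ⟨M', hM'⟩ := exists_residue (l + 1) s
    by_cases hc : residue (l + 1) n + residue (l + 1) s < Nat.fib (2 * (l + 1) + 1)
    · left
      apply residue_eq (M := M + M') _ hc
      push_cast
      linear_combination hM + hM'
    · right
      obtain ⟨t, ht⟩ : ∃ t, residue (l + 1) n + residue (l + 1) s =
        t + Nat.fib (2 * (l + 1) + 1) := ⟨_, (Nat.sub_add_cancel (by omega)).symm⟩
      rw [ht]
      have ht' : (residue (l + 1) n : ℤ) + residue (l + 1) s =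
        t + Nat.fib (2 * (l + 1) + 1) := by exact_mod_cast ht
      rw [residue_eq (r := t) (M := M + M' + 1) _ (by omega)]
      push_cast
      linear_combination hM + hM' + ht'
  unfold rotationLetter
  split_ifs <;> omega

theorem rotationLetter_pred_of_eq_one {L n : ℕ} (h : rotationLetter L n = 1) :
    1 ≤ n ∧ rotationLetter L (n - 1) = 0 := by
  have hn : 1 ≤ n := by
    by_contra! h0
    obtain rfl : n = 0 := by omega
    rw [rotationLetter_zero] at h
    omega
  refine ⟨hn, ?_⟩
  have hr := residue_lt L n
  obtain ⟨M, hM⟩ := exists_residue L n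
  rw [rotationLetter_eq_one_iff] at h
  have key : residue L (n - 1) = residue L n - Nat.fib (2 * L) := by
    apply residue_eq (M := M) _ (by omega)
    push_cast [hn, show Nat.fib (2 * L) ≤ residue L n by omega]
    linear_combination hM
  unfold rotationLetter
  rw [key]
  split_ifs <;> omega

theorem rotationLetter_pred_of_eq_two {L n : ℕ} (h : rotationLetter L n = 2) :
    1 ≤ n ∧ 1 ≤ L ∧ rotationLetter L (n - 1) = 1 := by
  have hn : 1 ≤ n := by
    by_contra! h0
    obtain rfl : n = 0 := by omega
    rw [rotationLetter_zero] at h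
    omega
  refine ⟨hn, ?_⟩
  rcases L with _ | l
  · simp [rotationLetter, residue] at h
  refine ⟨by omega, ?_⟩
  have h1 := fib_two_mul_succ l
  have h2 := fib_two_mul_succ_add_one l
  have h4 := fib_two_mul_le l
  have hr := residue_lt (l + 1) n
  obtain ⟨M, hM⟩ := exists_residue (l + 1) n
  rw [rotationLetter_eq_two_iff] at h
  have key : residue (l + 1) (n - 1) =
      residue (l + 1) n + Nat.fib (2 * (l + 1) + 1) - Nat.fib (2 * (l + 1)) := by
    apply residue_eq (M := M - 1) _ (by omega)
    push_cast [hn, show Nat.fib (2 * (l + 1)) ≤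
      residue (l + 1) n + Nat.fib (2 * (l + 1) + 1) by omega]
    linear_combination hM
  unfold rotationLetter
  rw [key]
  split_ifs <;> omega

/-- Best approximation: the bound is the residue of F(2k+1). -/
theorem fib_le_residue {k e n : ℕ} (h1 : 1 ≤ n) (h2 : n < Nat.fib (2 * (k + 1) + 1)) :
    Nat.fib (2 * e + 2) ≤ residue (k + 1 + e) n := by
  by_contra! hlt
  obtain ⟨M, hM⟩ := exists_residue (k + 1 + e) n
  obtain ⟨x, y, hxy, hxy'⟩ := exists_fib_coordinates k e n M
  have hz : (residue (k + 1 + e) n : ℤ) = x * Nat.fib (2 * e + 2) - y * Nat.fib (2 * e + 1) := by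
    rw [← hxy', hM]
    ring
  have h0 : (0 : ℤ) ≤ residue (k + 1 + e) n := by positivity
  have hlt' : (residue (k + 1 + e) n : ℤ) < Nat.fib (2 * e + 2) := by exact_mod_cast hlt
  have g' : (0 : ℤ) < Nat.fib (2 * e + 1) := by exact_mod_cast fib_odd_pos e
  have g : (0 : ℤ) < Nat.fib (2 * e + 2) := by exact_mod_cast Nat.fib_pos.mpr (by omega)
  have p1 : (0 : ℤ) < Nat.fib (2 * k + 1) := by exact_mod_cast fib_odd_pos k
  have p2 : (0 : ℤ) < Nat.fib (2 * k + 2) := by exact_mod_cast Nat.fib_pos.mpr (by omega)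
  have hn : (1 : ℤ) ≤ n := by exact_mod_cast h1
  have hn' : (n : ℤ) < Nat.fib (2 * k + 1) + Nat.fib (2 * k + 2) := by
    rw [show 2 * (k + 1) + 1 = 2 * k + 1 + 2 by ring, Nat.fib_add_two] at h2
    exact_mod_cast h2
  rcases lt_trichotomy y 0 with hy | hy | hy
  · have : x < 1 := by
      by_contra! hx
      nlinarith
    nlinarith
  · subst hy
    have : 0 < x := by
      by_contra! hx
      nlinarith
    nlinarith
  · have : 0 < x := by
      by_contra! hx
      nlinarith
    nlinarith

theorem strictMono_fib_odd : StrictMono fun i => Nat.fib (2 * i + 1) :=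
  strictMono_nat_of_lt_succ fun i => by
    have h2 := fib_two_mul_succ_add_one i
    have h3 := fib_odd_pos i
    omega

theorem exists_rotationLetter_sub_eq_zero {L n : ℕ} (h : rotationLetter L n = 2) :
    ∃ k, 1 ≤ k ∧ k ≤ L ∧ Nat.fib (2 * k + 1) - 1 ≤ n ∧
      rotationLetter L (n - (Nat.fib (2 * k + 1) - 1)) = 0 := by
  obtain ⟨hn, hL, -⟩ := rotationLetter_pred_of_eq_two h
  obtain ⟨l, rfl⟩ : ∃ l, L = l + 1 := ⟨L - 1, by omega⟩
  have h1 := fib_two_mul_succ l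
  have h2 := fib_two_mul_succ_add_one l
  have h4 := fib_two_mul_le l
  have hr := residue_lt (l + 1) n
  obtain ⟨M, hM⟩ := exists_residue (l + 1) n
  rw [rotationLetter_eq_two_iff] at h
  -- The move a_k - 1 goes to n + 1 - a_k. The residue of n + 1 is already in the interval of letter
  -- 0, so a_k only has to lower it without passing below 0.
  have hsucc : residue (l + 1) (n + 1) = residue (l + 1) n - Nat.fib (2 * l + 1) := by
    apply residue_eq (M := M + 1) _ (by omega)
    push_cast [show Nat.fib (2 * l + 1) ≤ residue (l + 1) n by omega]
    have h1' : (Nat.fib (2 * (l + 1)) : ℤ) = Nat.fib (2 * l) + Nat.fib (2 * l + 1) := by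
      exact_mod_cast h1
    have h2' : (Nat.fib (2 * (l + 1) + 1) : ℤ) = Nat.fib (2 * l) + 2 * Nat.fib (2 * l + 1) := by
      exact_mod_cast h2
    linear_combination hM + h1' - h2'
  -- If a full period fits into n + 1, removing it keeps the residue. Otherwise a_k ≤ n + 1 <
  -- a_{k+1} for some k, and `fib_le_residue` shows that the residue of a_k can be subtracted.
  by_cases hbig : Nat.fib (2 * (l + 1) + 1) ≤ n + 1
  · refine ⟨l + 1, by omega, le_rfl, by omega, ?_⟩
    have key : residue (l + 1) (n - (Nat.fib (2 * (l + 1) + 1) - 1)) =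
        residue (l + 1) (n + 1) := by
      conv_rhs => rw [show n + 1 = n - (Nat.fib (2 * (l + 1) + 1) - 1) +
        Nat.fib (2 * (l + 1) + 1) by have := fib_odd_pos (l + 1); omega]
      simp [residue, mul_add]
    unfold rotationLetter
    rw [key, hsucc]
    split_ifs <;> omega
  · push Not at hbig
    have hex : ∃ k, n + 1 < Nat.fib (2 * (k + 1) + 1) := ⟨l, hbig⟩
    classical
    set k := Nat.find hex with hk
    have hk1 : n + 1 < Nat.fib (2 * (k + 1) + 1) := Nat.find_spec hex
    have hkl : k ≤ l := Nat.find_min' hex hbig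
    have hk0 : 1 ≤ k := by
      by_contra! h0
      have : k = 0 := by omega
      rw [this] at hk1
      simp [Nat.fib_add_two] at hk1
      omega
    have hk2 : Nat.fib (2 * k + 1) ≤ n + 1 := by
      have := Nat.find_min hex (m := k - 1) (by omega)
      rw [show k - 1 + 1 = k by omega] at this
      omega
    obtain ⟨e, rfl⟩ : ∃ e, l = k + e := ⟨l - k, by omega⟩
    have hres := fib_le_residue (e := e) (show 1 ≤ n + 1 by omega) hk1
    rw [show k + 1 + e = k + e + 1 by ring, hsucc] at hres
    refine ⟨k, hk0, by omega, by omega, ?_⟩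
    have hpos := fib_odd_pos k
    have key : residue (k + e + 1) (n - (Nat.fib (2 * k + 1) - 1)) =
        residue (k + e + 1) n - Nat.fib (2 * (k + e) + 1) - Nat.fib (2 * e + 2) := by
      have hg := (fib_convergent_identities k e).1
      rw [show k + 1 + e = k + e + 1 by ring] at hg
      apply residue_eq (M := M + 1 - Nat.fib (2 * k)) _ (by omega)
      rw [Nat.sub_sub]
      push_cast [show Nat.fib (2 * k + 1) - 1 ≤ n by omega, show 1 ≤ Nat.fib (2 * k + 1) from hpos,
        show Nat.fib (2 * (k + e) + 1) + Nat.fib (2 * e + 2) ≤ residue (k + e + 1) n by omega]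
      have h1' : (Nat.fib (2 * (k + e + 1)) : ℤ) =
          Nat.fib (2 * (k + e)) + Nat.fib (2 * (k + e) + 1) := by exact_mod_cast h1
      have h2' : (Nat.fib (2 * (k + e + 1) + 1) : ℤ) =
          Nat.fib (2 * (k + e)) + 2 * Nat.fib (2 * (k + e) + 1) := by exact_mod_cast h2
      linear_combination hM - hg + h1' - h2'
    unfold rotationLetter
    rw [key]
    split_ifs <;> omega

/-! ### Digit patterns excluded by minimality -/

theorem IsRepresentation.sum_le_of_exchange {b d u v : ℕ → ℕ} {n j : ℕ}
    (h : IsRepresentation b n j d) (hu : ∀ k, u k ≤ d k)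
    (huv : ∑ k ∈ Finset.range (j + 2), u k * b k = ∑ k ∈ Finset.range (j + 2), v k * b k) :
    ∑ k ∈ Finset.range (j + 2), u k ≤ ∑ k ∈ Finset.range (j + 2), v k := by
  have hd : d (j + 1) = 0 := h.digit_eq_zero _ (by omega)
  have split_sum : ∀ k, d k = d k - u k + u k := fun k => (Nat.sub_add_cancel (hu k)).symm
  have hval : ∑ k ∈ Finset.range (j + 2), d k * b k = n := by
    rw [Finset.sum_range_succ, hd, h.sum_eq]
    simp
  have hval' : ∑ k ∈ Finset.range (j + 2), (d k - u k + v k) * b k = n := by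
    rw [← hval]
    conv_rhs => enter [2, k]; rw [split_sum k]
    simp only [add_mul, Finset.sum_add_distrib]
    rw [huv]
  have hsum : ∑ k ∈ Finset.range (j + 2), d k =
      ∑ k ∈ Finset.range (j + 2), (d k - u k) + ∑ k ∈ Finset.range (j + 2), u k := by
    rw [← Finset.sum_add_distrib]
    exact Finset.sum_congr rfl fun k _ => split_sum k
  -- An exchange may formally carry into place j + 1, but n < b_{j+1} leaves no room there.
  have htop : d (j + 1) - u (j + 1) + v (j + 1) = 0 := by
    by_contra h0
    have h1 := h.lt_index
    rw [Finset.sum_range_succ] at hval'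
    have h2 : 1 * b (j + 1) ≤ (d (j + 1) - u (j + 1) + v (j + 1)) * b (j + 1) :=
      Nat.mul_le_mul_right _ (by omega)
    omega
  have hmin := h.minimal (fun k => d k - u k + v k) (by
    rw [Finset.sum_range_succ, htop] at hval'
    simpa using hval')
  have h1 : ∑ k ∈ Finset.range (j + 2), d k = ∑ k ∈ Finset.range (j + 1), d k := by
    rw [Finset.sum_range_succ, hd, add_zero]
  have h2 : ∑ k ∈ Finset.range (j + 2), (d k - u k + v k) =
      ∑ k ∈ Finset.range (j + 1), (d k - u k + v k) := by
    rw [Finset.sum_range_succ, htop, add_zero]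
  rw [Finset.sum_add_distrib] at h2
  omega

theorem a_add_two (i : ℕ) : a (i + 2) + a i = 3 * a (i + 1) := by
  have h1 := fib_two_mul_succ i
  have h2 := fib_two_mul_succ_add_one i
  have h3 := fib_two_mul_succ_add_one (i + 1)
  simp only [a_eq_fib]
  simp only [add_assoc, Nat.reduceAdd] at h3
  omega

theorem a_zero : a 0 = 1 := by simp [a]

theorem a_one : a 1 = 2 := by simp [a_eq_fib, Nat.fib_add_two]

/-- Telescoping of `a_add_two`. In digits, 2 1…1 2 (a single 3 if M = m + 1) has the value of one
unit on each side of it. -/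
theorem sum_Icc_a_succ {m M : ℕ} (h : m + 1 ≤ M) :
    ∑ k ∈ Finset.Icc (m + 1) M, a k + a (m + 1) + a M = a (M + 1) + a m := by
  induction M, h using Nat.le_induction with
  | base =>
      have : a (m + 1 + 1) + a m = 3 * a (m + 1) := a_add_two m
      simp only [Finset.Icc_self, Finset.sum_singleton]
      omega
  | succ M hM ih =>
      have := a_add_two M
      rw [Finset.sum_Icc_succ_top (by omega)]
      simp only [add_assoc, Nat.reduceAdd] at *
      omega

theorem sum_Icc_a_zero (M : ℕ) : ∑ k ∈ Finset.Icc 0 M, a k + a M = a (M + 1) := by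
  induction M with
  | zero => simp [a_zero, a_one]
  | succ M ih =>
      have := a_add_two M
      rw [Finset.sum_Icc_succ_top (by omega)]
      simp only [add_assoc, Nat.reduceAdd] at *
      omega

theorem sum_range_ite_Icc_mul {m M N : ℕ} (h : M < N) (f : ℕ → ℕ) :
    ∑ k ∈ Finset.range N, (if m ≤ k ∧ k ≤ M then 1 else 0) * f k =
      ∑ k ∈ Finset.Icc m M, f k := by
  simp only [ite_mul, one_mul, zero_mul]
  rw [← Finset.sum_filter]
  congr 1
  ext k
  simp only [Finset.mem_filter, Finset.mem_range, Finset.mem_Icc]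
  omega

theorem sum_range_ite_eq_mul {M N : ℕ} (h : M < N) (f : ℕ → ℕ) :
    ∑ k ∈ Finset.range N, (if k = M then 1 else 0) * f k = f M := by
  simp [h]

/-! ### Two-blocks and residues -/

/-- The digits from place `m` upwards start with `1^l 2` for some `l`. -/
def StartsBlock (d : ℕ → ℕ) (m : ℕ) : Prop :=
  ∃ l, d (m + l) = 2 ∧ ∀ k, m ≤ k → k < m + l → d k = 1

theorem startsBlock_iff (d : ℕ → ℕ) (m : ℕ) :
    StartsBlock d m ↔ d m = 2 ∨ d m = 1 ∧ StartsBlock d (m + 1) := by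
  constructor
  · rintro ⟨l, hl, hk⟩
    rcases l with _ | l
    · exact Or.inl hl
    · refine Or.inr ⟨hk m le_rfl (by omega), l, ?_, fun k h1 h2 => hk k (by omega) (by omega)⟩
      rw [← hl]
      congr 1
      ring
  · rintro (h | ⟨h, l, hl, hk⟩)
    · exact ⟨0, h, fun k h1 h2 => by omega⟩
    · refine ⟨l + 1, ?_, fun k h1 h2 => ?_⟩
      · rw [← hl]
        congr 1
        ring
      · rcases h1.eq_or_lt with rfl | h1
        · exact h
        · exact hk k (by omega) (by omega)

theorem endsInTwoBlock_iff (d : ℕ → ℕ) : EndsInTwoBlock d ↔ StartsBlock d 1 ∧ d 0 = 0 := by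
  constructor
  · rintro ⟨m, h1, h2, h3⟩
    exact ⟨⟨m, by rw [add_comm]; exact h1, fun k hk hk' => h2 k hk (by omega)⟩, h3⟩
  · rintro ⟨⟨m, h1, h2⟩, h3⟩
    exact ⟨m, by rw [add_comm]; exact h1, fun k hk hk' => h2 k hk (by omega), h3⟩

namespace IsRepresentation

variable {n j : ℕ} {d : ℕ → ℕ}

theorem not_le_digits_succ (h : IsRepresentation a n j d) {m M : ℕ} (hM : m + 1 ≤ M) :
    ¬ ∀ k, (if m + 1 ≤ k ∧ k ≤ M then 1 else 0) + (if k = m + 1 then 1 else 0) +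
      (if k = M then 1 else 0) ≤ d k := by
  intro hu
  have hMj : M ≤ j := by
    by_contra! hlt
    have h1 := hu M
    rw [h.digit_eq_zero M hlt] at h1
    simp at h1
  have key := h.sum_le_of_exchange (v := fun k => (if k = M + 1 then 1 else 0) +
    (if k = m then 1 else 0)) hu (by
      simp only [add_mul, Finset.sum_add_distrib]
      rw [sum_range_ite_Icc_mul (by omega), sum_range_ite_eq_mul (by omega),
        sum_range_ite_eq_mul (by omega), sum_range_ite_eq_mul (by omega),
        sum_range_ite_eq_mul (by omega), sum_Icc_a_succ hM])
  have h1 := sum_range_ite_Icc_mul (m := m + 1) (show M < j + 2 by omega) fun _ => 1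
  simp only [mul_one, Finset.sum_const, Nat.card_Icc, smul_eq_mul] at h1
  simp only [Finset.sum_add_distrib, Finset.sum_ite_eq', Finset.mem_range] at key
  rw [h1] at key
  split_ifs at key <;> omega

theorem not_le_digits_zero (h : IsRepresentation a n j d) (M : ℕ) :
    ¬ ∀ k, (if 0 ≤ k ∧ k ≤ M then 1 else 0) + (if k = M then 1 else 0) ≤ d k := by
  intro hu
  have hMj : M ≤ j := by
    by_contra! hlt
    have h1 := hu M
    rw [h.digit_eq_zero M hlt] at h1
    simp at h1
  have key := h.sum_le_of_exchange (v := fun k => if k = M + 1 then 1 else 0) hu (by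
      simp only [add_mul, Finset.sum_add_distrib]
      rw [sum_range_ite_Icc_mul (by omega), sum_range_ite_eq_mul (by omega),
        sum_range_ite_eq_mul (by omega), sum_Icc_a_zero])
  have h1 := sum_range_ite_Icc_mul (m := 0) (show M < j + 2 by omega) fun _ => 1
  simp only [mul_one, Finset.sum_const, Nat.card_Icc, smul_eq_mul] at h1
  simp only [Finset.sum_add_distrib, Finset.sum_ite_eq', Finset.mem_range] at key
  rw [h1] at key
  split_ifs at key <;> omega

theorem digit_succ_le_two (h : IsRepresentation a n j d) (m : ℕ) : d (m + 1) ≤ 2 := by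
  by_contra! hlt
  refine h.not_le_digits_succ (m := m) le_rfl fun k => ?_
  by_cases hk : k = m + 1
  · subst hk
    split_ifs <;> omega
  · split_ifs <;> omega

theorem digit_zero_le_one (h : IsRepresentation a n j d) : d 0 ≤ 1 := by
  by_contra! hlt
  refine h.not_le_digits_zero 0 fun k => ?_
  by_cases hk : k = 0
  · subst hk
    split_ifs <;> omega
  · split_ifs <;> omega

theorem not_startsBlock_of_digit_eq_two (h : IsRepresentation a n j d) {m : ℕ}
    (hm : d (m + 1) = 2) : ¬ StartsBlock d (m + 2) := by
  rintro ⟨l, hl, hk⟩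
  refine h.not_le_digits_succ (m := m) (M := m + 2 + l) (by omega) fun k => ?_
  rcases lt_trichotomy k (m + 1) with hlt | rfl | hlt
  · split_ifs <;> omega
  · split_ifs <;> omega
  · rcases lt_trichotomy k (m + 2 + l) with hlt' | rfl | hlt'
    · have := hk k (by omega) hlt'
      split_ifs <;> omega
    · split_ifs <;> omega
    · split_ifs <;> omega

theorem not_startsBlock_of_digit_zero_eq_one (h : IsRepresentation a n j d)
    (hm : d 0 = 1) : ¬ StartsBlock d 1 := by
  rintro ⟨l, hl, hk⟩
  refine h.not_le_digits_zero (1 + l) fun k => ?_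
  rcases Nat.eq_zero_or_pos k with rfl | hlt
  · split_ifs <;> omega
  · rcases lt_trichotomy k (1 + l) with hlt' | rfl | hlt'
    · have := hk k (by omega) hlt'
      split_ifs <;> omega
    · split_ifs <;> omega
    · split_ifs <;> omega

/-- Induction from the leading digit down. The excluded pattern 2 1…1 2 keeps the sum below the
bound when a digit 2 is prepended, and a digit 1 passes the block property on. -/
theorem residue_tail_bounds (h : IsRepresentation a n j d) (t m : ℕ)
    (hd : ∀ k, m + 1 + t ≤ k → d k = 0) :
    ∑ k ∈ Finset.range t, d (m + 1 + k) * Nat.fib (2 * (t - k)) < Nat.fib (2 * (t + 1)) ∧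
    (StartsBlock d (m + 1) ↔
      Nat.fib (2 * t + 1) ≤ ∑ k ∈ Finset.range t, d (m + 1 + k) * Nat.fib (2 * (t - k))) := by
  induction t generalizing m with
  | zero =>
      refine ⟨by simp, ?_⟩
      rw [startsBlock_iff, hd (m + 1) (by omega)]
      simp
  | succ t ih =>
      obtain ⟨ih1, ih2⟩ := ih (m + 1) fun k hk => hd k (by omega)
      have hsum : ∑ k ∈ Finset.range (t + 1), d (m + 1 + k) * Nat.fib (2 * (t + 1 - k)) =
          ∑ k ∈ Finset.range t, d (m + 1 + 1 + k) * Nat.fib (2 * (t - k)) +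
            d (m + 1) * Nat.fib (2 * (t + 1)) := by
        rw [Finset.sum_range_succ']
        congr 1
        refine Finset.sum_congr rfl fun k _ => ?_
        rw [show m + 1 + (k + 1) = m + 1 + 1 + k by ring, show t + 1 - (k + 1) = t - k by omega]
      rw [hsum]
      set R := ∑ k ∈ Finset.range t, d (m + 1 + 1 + k) * Nat.fib (2 * (t - k))
      have h1 := fib_two_mul_succ t
      have h2 := fib_two_mul_succ_add_one t
      have h1' := fib_two_mul_succ (t + 1)
      have h3 := fib_odd_pos t
      have h4 := fib_two_mul_le t
      rw [startsBlock_iff]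
      have hle := h.digit_succ_le_two m
      have hb := h.not_startsBlock_of_digit_eq_two (m := m)
      rw [show m + 1 + 1 = m + 2 by ring] at ih2 ⊢
      by_cases hblock : StartsBlock d (m + 2)
      · have ih3 := ih2.mp hblock
        simp only [hblock, not_true_eq_false, imp_false] at hb
        simp only [hblock]
        interval_cases d (m + 1) <;> simp <;> omega
      · have ih3 := mt ih2.mpr hblock
        simp only [hblock]
        interval_cases d (m + 1) <;> simp <;> omega

/-- At level j + 1 the residue of a_k is F(2(j+1-k)), by `fib_convergent_identities`. -/
theorem residue_eq_sum (h : IsRepresentation a n j d)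
    (hlt : ∑ k ∈ Finset.range (j + 1), d k * Nat.fib (2 * (j + 1 - k)) <
      Nat.fib (2 * (j + 1) + 1)) :
    residue (j + 1) n = ∑ k ∈ Finset.range (j + 1), d k * Nat.fib (2 * (j + 1 - k)) := by
  apply residue_eq (M := ∑ k ∈ Finset.range (j + 1), (d k * Nat.fib (2 * k) : ℤ)) _ hlt
  conv_lhs => rw [← h.sum_eq]
  push_cast
  rw [Finset.mul_sum, Finset.mul_sum, ← Finset.sum_add_distrib]
  refine Finset.sum_congr rfl fun k hk => ?_
  obtain ⟨e, he⟩ : ∃ e, j = k + e := ⟨j - k, by have := Finset.mem_range.mp hk; omega⟩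
  have hg := (fib_convergent_identities k e).1
  rw [show j + 1 - k = e + 1 by omega, show j + 1 = k + 1 + e by omega, a_eq_fib,
    show 2 * (e + 1) = 2 * e + 2 by ring]
  linear_combination (d k : ℤ) * hg

theorem endsInTwoBlock_iff_rotationLetter (h : IsRepresentation a n j d) :
    EndsInTwoBlock d ↔ rotationLetter (j + 1) n = 2 := by
  obtain ⟨h1, h2⟩ := h.residue_tail_bounds j 0 fun k hk => h.digit_eq_zero k (by omega)
  have hsum : ∑ k ∈ Finset.range (j + 1), d k * Nat.fib (2 * (j + 1 - k)) =
      ∑ k ∈ Finset.range j, d (0 + 1 + k) * Nat.fib (2 * (j - k)) +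
        d 0 * Nat.fib (2 * (j + 1)) := by
    rw [Finset.sum_range_succ']
    congr 1
    refine Finset.sum_congr rfl fun k _ => ?_
    rw [show 0 + 1 + k = k + 1 by ring, show j + 1 - (k + 1) = j - k by omega]
  have hres := h.residue_eq_sum
  rw [hsum] at hres
  set R := ∑ k ∈ Finset.range j, d (0 + 1 + k) * Nat.fib (2 * (j - k))
  have f1 := fib_two_mul_succ j
  have f2 := fib_two_mul_succ_add_one j
  rw [endsInTwoBlock_iff, rotationLetter_eq_two_iff]
  rw [zero_add] at h2
  rw [h2]
  have hle := h.digit_zero_le_one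
  have hb := h.not_startsBlock_of_digit_zero_eq_one
  rw [h2] at hb
  obtain h0 | h0 : d 0 = 0 ∨ d 0 = 1 := by omega
  · rw [h0] at hres
    rw [hres (by omega), h0]
    omega
  · have := hb h0
    rw [h0] at hres
    rw [hres (by omega), h0]
    omega

end IsRepresentation

theorem exists_isRepresentation {n : ℕ} (hn : 0 < n) : ∃ j d, IsRepresentation a n j d := by
  have hex : ∃ j, n < a (j + 1) := by
    refine ⟨n, ?_⟩
    rw [a, if_neg (by omega)]
    exact lt_length_word n
  classical
  obtain ⟨j, hj1, hj2⟩ : ∃ j, a j ≤ n ∧ n < a (j + 1) := by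
    refine ⟨Nat.find hex, ?_, Nat.find_spec hex⟩
    rcases hf : Nat.find hex with _ | k
    · rw [a_zero]
      exact hn
    · exact not_lt.mp (Nat.find_min hex (m := k) (by omega))
  have hne : ∃ w, ∃ d : ℕ → ℕ, ∑ i ∈ Finset.range (j + 1), d i * a i = n ∧
      ∑ i ∈ Finset.range (j + 1), d i = w := by
    refine ⟨_, fun i => if i = 0 then n else 0, ?_, rfl⟩
    rw [Finset.sum_range_succ']
    simp [a_zero]
  obtain ⟨d, hd1, hd2⟩ := Nat.find_spec hne
  have trunc : ∀ f : ℕ → ℕ, ∑ i ∈ Finset.range (j + 1), f i * (if i ≤ j then 1 else 0) =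
      ∑ i ∈ Finset.range (j + 1), f i := fun f =>
    Finset.sum_congr rfl fun i hi => by
      rw [if_pos (by have := Finset.mem_range.mp hi; omega), mul_one]
  refine ⟨j, fun i => d i * (if i ≤ j then 1 else 0), hj1, hj2, fun i hi => ?_, ?_, fun e he => ?_⟩
  · rw [if_neg (by omega), mul_zero]
  · rw [← hd1, ← trunc fun i => d i * a i]
    exact Finset.sum_congr rfl fun i _ => by ring
  · rw [trunc, hd2]
    exact Nat.find_min' hne ⟨e, he, rfl⟩

theorem IsRepresentation.endsInTwoBlock_iff_limitWord {n j : ℕ} {d : ℕ → ℕ}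
    (h : IsRepresentation a n j d) : EndsInTwoBlock d ↔ limitWord n = 2 := by
  rw [h.endsInTwoBlock_iff_rotationLetter, limitWord_eq_rotationLetter h.lt_index]

theorem limitWord_zero : limitWord 0 = 0 := by simp [limitWord, word_one]

theorem mem_I_iff {n : ℕ} : n ∈ I ↔ n = 1 ∨ limitWord n = 2 := by
  constructor
  · rintro (h | ⟨-, j, d, hd, hb⟩)
    · exact Or.inl h
    · exact Or.inr (hd.endsInTwoBlock_iff_limitWord.mp hb)
  · rintro (h | h)
    · exact Or.inl h
    · have hn : 0 < n := by
        by_contra! h0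
        obtain rfl : n = 0 := by omega
        rw [limitWord_zero] at h
        omega
      obtain ⟨j, d, hd⟩ := exists_isRepresentation hn
      exact Or.inr ⟨hn, j, d, hd, hd.endsInTwoBlock_iff_limitWord.mpr h⟩

/-- At level i ≥ 2, a_i is the modulus, so a_i - 1 has residue -q, the left endpoint of the interval
of letter 2. -/
theorem T_subset_I : T ⊆ I := by
  rintro n ⟨i, hi, rfl⟩
  rw [mem_I_iff]
  obtain ⟨l, rfl⟩ : ∃ l, i = l + 1 := ⟨i - 1, by omega⟩
  rcases l with _ | l
  · left
    simp [a_one]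
  · right
    have hpos : 0 < a (l + 2) := by
      rw [a_eq_fib]
      exact fib_odd_pos _
    rw [limitWord_eq_rotationLetter (i := l + 2) (Nat.sub_lt hpos one_pos), rotationLetter_eq_two_iff]
    have h1 := fib_two_mul_succ l
    have h2 := fib_two_mul_succ_add_one l
    have h1' := fib_two_mul_succ (l + 1)
    have h2' := fib_two_mul_succ_add_one (l + 1)
    have h3 := fib_odd_pos l
    have h4 := fib_two_mul_le l
    simp only [add_assoc, Nat.reduceAdd] at h1' h2'
    have hres : residue (l + 2) (a (l + 2) - 1) =
        Nat.fib (2 * (l + 2) + 1) - Nat.fib (2 * (l + 2)) := by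
      apply residue_eq (M := Nat.fib (2 * (l + 2)) - 1) _ (by omega)
      rw [a_eq_fib] at hpos ⊢
      push_cast [show 1 ≤ Nat.fib (2 * (l + 2) + 1) from hpos,
        show Nat.fib (2 * (l + 2)) ≤ Nat.fib (2 * (l + 2) + 1) by omega]
      ring
    rw [hres]
    omega

/-! ### The Nim sequences -/

theorem SG_eq_of_forall {S : Set ℕ} {n v : ℕ}
    (hne : ∀ s ∈ S, 0 < s → s ≤ n → SG S (n - s) ≠ v)
    (hex : ∀ u < v, ∃ s ∈ S, 0 < s ∧ s ≤ n ∧ SG S (n - s) = u) : SG S n = v := by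
  rw [SG, mex]
  refine IsLeast.csInf_eq ⟨?_, fun u hu => ?_⟩
  · rintro ⟨s, ⟨h1, h2, h3⟩, h4⟩
    exact hne s h1 h2 h3 h4
  · by_contra! hlt
    obtain ⟨s, h1, h2, h3, h4⟩ := hex u hlt
    exact hu ⟨s, ⟨h1, h2, h3⟩, h4⟩

theorem SG_congr {S S' : Set ℕ} {n : ℕ} (h : ∀ s ≤ n, s ∈ S ↔ s ∈ S') : SG S n = SG S' n := by
  induction n using Nat.strong_induction_on with
  | _ n ih =>
      rw [SG, SG]
      congr 1
      ext v
      constructor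
      · rintro ⟨s, ⟨h1, h2, h3⟩, h4⟩
        exact ⟨s, ⟨(h s h3).mp h1, h2, h3⟩, by
          rw [← h4, ih (n - s) (by omega) fun t ht => h t (by omega)]⟩
      · rintro ⟨s, ⟨h1, h2, h3⟩, h4⟩
        exact ⟨s, ⟨(h s h3).mpr h1, h2, h3⟩, by
          rw [← h4, ih (n - s) (by omega) fun t ht => h t (by omega)]⟩

theorem a_strictMono : StrictMono a := by
  intro i j h
  rw [a_eq_fib, a_eq_fib]
  exact strictMono_fib_odd h

theorem a_pos (i : ℕ) : 0 < a i := by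
  rw [a_eq_fib]
  exact fib_odd_pos i

theorem lt_a (n : ℕ) : n < a n := by
  induction n with
  | zero => exact a_pos 0
  | succ n ih => exact lt_of_le_of_lt ih (a_strictMono (by omega))

theorem rotationLetter_le_two (L n : ℕ) : rotationLetter L n ≤ 2 := by
  unfold rotationLetter
  split_ifs <;> omega

theorem rotationLetter_add_ne_of_mem_I {L s : ℕ} (hs : s ∈ I) (hsL : s < a L) (n : ℕ) :
    rotationLetter L (n + s) ≠ rotationLetter L n := by
  apply rotationLetter_ne_of_add
  rcases mem_I_iff.mp hs with rfl | h
  · refine Or.inl ⟨rfl, ?_⟩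
    by_contra! h0
    obtain rfl : L = 0 := by omega
    simp [a_zero] at hsL
  · right
    rw [← limitWord_eq_rotationLetter hsL, h]

/-- The upper bound I ensures that no move keeps the letter, and the lower bound T supplies moves to
all smaller letters. Since s < a_i, the letter of s at level i is w[s]. -/
theorem SG_truncation {S : Set ℕ} (hT : T ⊆ S) (hI : S ⊆ I) (i n : ℕ) :
    SG {s | s ∈ S ∧ s < a i} n = rotationLetter i n := by
  induction n using Nat.strong_induction_on with
  | _ n ih =>
      have supply : ∀ k u, 1 ≤ k → k ≤ i → a k - 1 ≤ n →
          rotationLetter i (n - (a k - 1)) = u →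
          ∃ s ∈ {s | s ∈ S ∧ s < a i}, 0 < s ∧ s ≤ n ∧
            SG {s | s ∈ S ∧ s < a i} (n - s) = u := by
        intro k u hk hki hle hu
        have h1 := a_strictMono.monotone hk
        have h2 := a_strictMono.monotone hki
        rw [a_one] at h1
        refine ⟨a k - 1, ⟨hT ⟨k, hk, rfl⟩, by omega⟩, by omega, hle, ?_⟩
        rw [ih _ (by omega), hu]
      refine SG_eq_of_forall (fun s hs hs0 hsn => ?_) fun u hu => ?_
      · rw [ih _ (by omega)]
        have := rotationLetter_add_ne_of_mem_I (hI hs.1) hs.2 (n - s)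
        rw [Nat.sub_add_cancel hsn] at this
        exact this.symm
      · have hv := rotationLetter_le_two i n
        have h1 : ∀ v, rotationLetter i n = v → 1 ≤ v → 1 ≤ i := by
          rintro v rfl h
          by_contra! h0
          obtain rfl : i = 0 := by omega
          simp [rotationLetter, residue] at h
        obtain h | h : rotationLetter i n = 1 ∨ rotationLetter i n = 2 := by omega
        · obtain ⟨hn, h0⟩ := rotationLetter_pred_of_eq_one h
          obtain rfl : u = 0 := by omega
          exact supply 1 0 le_rfl (h1 _ h le_rfl) (by rw [a_one]; exact hn) (by rw [a_one]; exact h0)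
        · obtain rfl | rfl : u = 0 ∨ u = 1 := by omega
          · obtain ⟨k, hk, hki, hle, h0⟩ := exists_rotationLetter_sub_eq_zero h
            rw [← a_eq_fib] at hle h0
            exact supply k 0 hk hki hle h0
          · obtain ⟨hn, hi, h0⟩ := rotationLetter_pred_of_eq_two h
            exact supply 1 1 le_rfl hi (by rw [a_one]; exact hn) (by rw [a_one]; exact h0)

theorem rotationLetter_eq_limitWord_mod (i n : ℕ) :
    rotationLetter i n = limitWord (n % a i) := by
  rw [limitWord_eq_rotationLetter (Nat.mod_lt _ (a_pos i)), a_eq_fib, rotationLetter_mod]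

theorem SG_eq_limitWord {S : Set ℕ} (hT : T ⊆ S) (hI : S ⊆ I) (n : ℕ) :
    SG S n = limitWord n := by
  have hn := lt_a n
  rw [limitWord_eq_rotationLetter hn, ← SG_truncation hT hI]
  exact SG_congr fun s hs => ⟨fun h => ⟨h, by omega⟩, fun h => h.1⟩

theorem limitWord_add_ne {s : ℕ} (hs : s ∈ I) (n : ℕ) : limitWord (n + s) ≠ limitWord n := by
  have h := lt_a (n + s)
  rw [limitWord_eq_rotationLetter h,
    limitWord_eq_rotationLetter (i := n + s) (n := n) (by omega)]
  exact rotationLetter_add_ne_of_mem_I hs (by omega) n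

/-! ### Aperiodicity and range -/

theorem exists_fib_odd_modEq_one {p : ℕ} (hp : 0 < p) :
    ∃ t, 1 ≤ t ∧ Nat.fib (2 * t + 1) ≡ 1 [MOD p] := by
  have : NeZero p := ⟨hp.ne'⟩
  let f : ZMod p × ZMod p → ZMod p × ZMod p := fun x => (x.2, x.1 + x.2)
  have hf : Function.Injective f := by
    rintro ⟨x, y⟩ ⟨x', y'⟩ h
    simp only [f, Prod.mk.injEq] at h
    obtain ⟨rfl, h⟩ := h
    simpa using h
  have hiter : ∀ m, f^[m] (0, 1) = ((Nat.fib m : ZMod p), (Nat.fib (m + 1) : ZMod p)) := by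
    intro m
    induction m with
    | zero => simp
    | succ m ih =>
        rw [Function.iterate_succ_apply', ih]
        simp [f, Nat.fib_add_two]
  obtain ⟨t, ht, hper⟩ := Function.mem_periodicPts.mp (hf.mem_periodicPts (0, 1))
  refine ⟨t, ht, ?_⟩
  -- The Fibonacci map is injective on a finite set, hence (0, 1) is periodic; doubling the period
  -- gives an odd index 2t + 1.
  have h2 : f^[2 * t] (0, 1) = (0, 1) := (hper.const_mul 2)
  rw [hiter, Prod.mk.injEq] at h2
  rw [← ZMod.natCast_eq_natCast_iff, h2.2]
  simp

theorem not_eventuallyPeriodic_limitWord : ¬ EventuallyPeriodic limitWord := by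
  rintro ⟨p, hp, N, hN⟩
  obtain ⟨t, ht, hmod⟩ := exists_fib_odd_modEq_one hp
  have hdvd := (Nat.modEq_iff_dvd' (a_pos t)).mp (by rw [a_eq_fib]; exact hmod.symm)
  obtain ⟨k, hk⟩ := hdvd
  have hmul : ∀ k, limitWord (N + p * k) = limitWord N := by
    intro k
    induction k with
    | zero => simp
    | succ k ih => rw [mul_add, mul_one, ← add_assoc, hN _ (by omega), ih]
  refine limitWord_add_ne (T_subset_I ⟨t, ht, rfl⟩) N ?_
  rw [hk, hmul]

theorem range_limitWord : Set.range limitWord = {0, 1, 2} := by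
  apply Set.Subset.antisymm
  · rintro _ ⟨n, rfl⟩
    have h := rotationLetter_le_two n n
    rw [← limitWord_eq_rotationLetter (lt_a n)] at h
    simp only [Set.mem_insert_iff, Set.mem_singleton_iff]
    omega
  · rintro v (rfl | rfl | rfl)
    · exact ⟨0, limitWord_zero⟩
    · refine ⟨1, ?_⟩
      rw [limitWord_eq_rotationLetter (i := 1) (by simp [a_one])]
      exact rotationLetter_one 0
    · refine ⟨4, ?_⟩
      rw [limitWord_eq_rotationLetter (i := 2) (by simp [a_eq_fib, Nat.fib_add_two])]
      exact (rotationLetter_two_three_four 0).2.2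

/-! ### Density of the letter 2 -/

theorem residue_succ (L n : ℕ) :
    Nat.fib (2 * L) * (n + 1) / Nat.fib (2 * L + 1) = Nat.fib (2 * L) * n / Nat.fib (2 * L + 1) +
        (if Nat.fib (2 * L + 1) ≤ residue L n + Nat.fib (2 * L) then 1 else 0) ∧
      residue L (n + 1) + (if Nat.fib (2 * L + 1) ≤ residue L n + Nat.fib (2 * L) then
        Nat.fib (2 * L + 1) else 0) = residue L n + Nat.fib (2 * L) := by
  have hle := fib_two_mul_le L
  have hlt := residue_lt L n
  have h0 := Nat.div_add_mod (Nat.fib (2 * L) * n) (Nat.fib (2 * L + 1))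
  change _ + residue L n = _ at h0
  unfold residue at hlt h0 ⊢
  set q := Nat.fib (2 * L)
  set b := Nat.fib (2 * L + 1)
  set K := q * n / b
  set r := q * n % b
  by_cases hc : b ≤ r + q
  · obtain ⟨t, ht⟩ : ∃ t, r + q = t + b := ⟨_, (Nat.sub_add_cancel hc).symm⟩
    obtain ⟨h1, h2⟩ := (Nat.div_mod_unique (a := q * (n + 1)) (d := K + 1) (c := t)
      (fib_odd_pos L)).mpr ⟨by linarith, by omega⟩
    rw [if_pos hc, if_pos hc]
    exact ⟨h1, by rw [h2, ht]⟩
  · obtain ⟨h1, h2⟩ := (Nat.div_mod_unique (a := q * (n + 1)) (d := K) (c := r + q)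
      (fib_odd_pos L)).mpr ⟨by linarith, by omega⟩
    rw [if_neg hc, if_neg hc]
    exact ⟨h1, by rw [h2, add_zero]⟩

/-- The rotation wraps on leaving n unless letter n is 0, and on arriving at n unless letter n is 1.
So the two wrap counts add up to 2 at the letter 2 and to 1 elsewhere, and each sums to a floor. -/
theorem card_limitWord_eq_two {l N : ℕ} (hN : N < a (l + 1)) :
    ((Finset.Icc 1 N).filter fun n => limitWord n = 2).card + N =
      Nat.fib (2 * (l + 1)) * N / Nat.fib (2 * (l + 1) + 1) +
        Nat.fib (2 * (l + 1)) * (N + 1) / Nat.fib (2 * (l + 1) + 1) := by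
  have h1 := fib_two_mul_succ l
  have h2 := fib_two_mul_succ_add_one l
  have h3 := fib_odd_pos l
  induction N with
  | zero =>
      have h0 : Nat.fib (2 * (l + 1)) / Nat.fib (2 * (l + 1) + 1) = 0 :=
        Nat.div_eq_of_lt (by omega)
      simp [h0]
  | succ N ih =>
      have ih := ih (by omega)
      rw [← Finset.insert_Icc_right_eq_Icc_add_one (by omega), Finset.filter_insert]
      obtain ⟨s1, s2⟩ := residue_succ (l + 1) N
      obtain ⟨s3, -⟩ := residue_succ (l + 1) (N + 1)
      have hr := residue_lt (l + 1) N
      have hlet := rotationLetter_eq_two_iff (L := l + 1) (n := N + 1)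
      rw [← limitWord_eq_rotationLetter hN] at hlet
      rw [s3]
      by_cases hw : limitWord (N + 1) = 2
      · rw [if_pos hw, Finset.card_insert_of_notMem (by simp)]
        have := hlet.mp hw
        split_ifs at * <;> omega
      · rw [if_neg hw]
        rw [hlet] at hw
        split_ifs at * <;> omega

theorem abs_card_limitWord_eq_two_sub_le (N : ℕ) :
    |(((Finset.Icc 1 N).filter fun n => limitWord n = 2).card : ℝ) -
      (2 / Real.goldenRatio - 1) * N| ≤ 4 := by
  have hN : N < a (N + 1) := (lt_a N).trans (a_strictMono (by omega))
  have hc := card_limitWord_eq_two hN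
  set c := ((Finset.Icc 1 N).filter fun n => limitWord n = 2).card
  rw [a_eq_fib] at hN
  have hpsi : |Real.goldenConj ^ (2 * (N + 1))| ≤ 1 := by
    rw [abs_pow]
    apply pow_le_one₀ (abs_nonneg _)
    rw [abs_le]
    exact ⟨Real.neg_one_lt_goldenConj.le, (Real.goldenConj_neg.trans one_pos).le⟩
  rw [← Real.fib_succ_sub_goldenRatio_mul_fib] at hpsi
  have hqa := fib_two_mul_le (N + 1)
  have hb := fib_odd_pos (N + 1)
  set q := Nat.fib (2 * (N + 1))
  set b := Nat.fib (2 * (N + 1) + 1)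
  have hbR : (0 : ℝ) < b := by exact_mod_cast hb
  have floor_bounds : ∀ m : ℕ, (q * m / b : ℝ) - 1 < (q * m / b : ℕ) ∧
      ((q * m / b : ℕ) : ℝ) ≤ q * m / b := by
    intro m
    constructor
    · have := Nat.lt_floor_add_one ((q * m : ℕ) / b : ℝ)
      rw [Nat.floor_div_natCast, Nat.floor_natCast] at this
      push_cast at this ⊢
      linarith
    · have := Nat.cast_div_le (α := ℝ) (m := q * m) (n := b)
      push_cast at this
      exact this
  obtain ⟨u1, u2⟩ := floor_bounds N
  obtain ⟨v1, v2⟩ := floor_bounds (N + 1)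
  have hcR : (c : ℝ) + N = (q * N / b : ℕ) + (q * (N + 1) / b : ℕ) := by exact_mod_cast hc
  have hsplit : (q * ((N + 1 : ℕ) : ℝ) / b) = q * N / b + q / b := by
    push_cast
    ring
  rw [hsplit] at v1 v2
  have hq0 : (0 : ℝ) ≤ q / b := by positivity
  have hq1 : (q : ℝ) / b ≤ 1 := by
    rw [div_le_one hbR]
    exact_mod_cast hqa
  have hphi := Real.one_lt_goldenRatio
  -- The level depends on N, but |b - φq| ≤ 1 and N ≤ b keep the error bounded uniformly.
  have happrox : |(q * N / b : ℝ) - N / Real.goldenRatio| ≤ 1 := by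
    have e : (q * N / b : ℝ) - N / Real.goldenRatio =
        -((b - Real.goldenRatio * q) * (N / (b * Real.goldenRatio))) := by
      field_simp
      ring
    have hfrac : (N : ℝ) / (b * Real.goldenRatio) ≤ 1 := by
      rw [div_le_one (by positivity)]
      have : (N : ℝ) ≤ b := by exact_mod_cast hN.le
      nlinarith
    rw [e, abs_neg, abs_mul]
    refine mul_le_one₀ hpsi (abs_nonneg _) ?_
    rw [abs_of_nonneg (by positivity)]
    exact hfrac
  rw [abs_le] at happrox ⊢
  have e2 : (2 / Real.goldenRatio - 1) * N = 2 * (N / Real.goldenRatio) - N := by ring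
  rw [e2]
  constructor <;> linarith [happrox.1, happrox.2]

theorem hasPositiveDensity_I : HasPositiveDensity I := by
  refine ⟨2 / Real.goldenRatio - 1, ?_, ?_⟩
  · rw [sub_pos, one_lt_div Real.goldenRatio_pos]
    exact Real.goldenRatio_lt_two
  · have bound : ∀ N : ℕ, |((I ∩ Set.Icc 1 N).ncard : ℝ) - (2 / Real.goldenRatio - 1) * N| ≤ 5 := by
      intro N
      set A := (Finset.Icc 1 N).filter fun n => limitWord n = 2 with hA
      have h1 : A.card ≤ (I ∩ Set.Icc 1 N).ncard := by
        rw [← Set.ncard_coe_finset]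
        refine Set.ncard_le_ncard (fun n hn => ?_) ((Set.finite_Icc 1 N).inter_of_right I)
        simp only [hA, Finset.coe_filter, Finset.mem_Icc, Set.mem_ofPred_eq] at hn
        exact ⟨mem_I_iff.mpr (Or.inr hn.2), hn.1⟩
      have h2 : (I ∩ Set.Icc 1 N).ncard ≤ A.card + 1 := by
        refine le_trans ?_ (Finset.card_insert_le 1 A)
        rw [← Set.ncard_coe_finset]
        refine Set.ncard_le_ncard (fun n hn => ?_) (Finset.finite_toSet _)
        simp only [hA, Finset.coe_insert, Finset.coe_filter, Finset.mem_Icc]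
        rcases mem_I_iff.mp hn.1 with rfl | h
        · exact Or.inl rfl
        · exact Or.inr ⟨hn.2, h⟩
      have h3 := abs_le.mp (abs_card_limitWord_eq_two_sub_le N)
      have h1' : (A.card : ℝ) ≤ (I ∩ Set.Icc 1 N).ncard := by exact_mod_cast h1
      have h2' : ((I ∩ Set.Icc 1 N).ncard : ℝ) ≤ A.card + 1 := by exact_mod_cast h2
      rw [abs_le]
      constructor <;> linarith [h3.1, h3.2]
    rw [← tendsto_sub_nhds_zero_iff]
    refine squeeze_zero_norm' ?_ (tendsto_const_div_atTop_nhds_zero_nat (5 : ℝ))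
    filter_upwards [Filter.eventually_gt_atTop 0] with N hN
    have hNR : (0 : ℝ) < N := by exact_mod_cast hN
    rw [Real.norm_eq_abs, le_div_iff₀ hNR, ← abs_of_pos hNR, ← abs_mul, abs_of_pos hNR, sub_mul,
      div_mul_cancel₀ _ hNR.ne']
    exact bound N

end SubtractionGame

theorem mainTheorem1 :
    -- the lengths are the odd-indexed Fibonacci numbers, and the two extreme sets are nested
    (∀ i : ℕ, SubtractionGame.a i = Nat.fib (2 * i + 1)) ∧
    SubtractionGame.T ⊆ SubtractionGame.I ∧
    -- for every set between them, the Nim sequence is the limit word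
    (∀ S : Set ℕ, SubtractionGame.T ⊆ S → S ⊆ SubtractionGame.I →
      (∀ n : ℕ, SubtractionGame.SG S n = SubtractionGame.limitWord n) ∧
      -- the truncations have Nim sequence `(w[0..a_i))^ω`
      (∀ i n : ℕ, SubtractionGame.SG {s | s ∈ S ∧ s < SubtractionGame.a i} n =
        SubtractionGame.limitWord (n % SubtractionGame.a i))) ∧
    -- `I` has positive density, and its Nim sequence is ternary and aperiodic
    (SubtractionGame.HasPositiveDensity SubtractionGame.I ∧
      Set.range (SubtractionGame.SG SubtractionGame.I) = {0, 1, 2} ∧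
      ¬ SubtractionGame.EventuallyPeriodic (SubtractionGame.SG SubtractionGame.I)) := by
  have hI : SubtractionGame.SG SubtractionGame.I = SubtractionGame.limitWord :=
    funext (SubtractionGame.SG_eq_limitWord SubtractionGame.T_subset_I subset_rfl)
  refine ⟨SubtractionGame.a_eq_fib, SubtractionGame.T_subset_I, fun S hT hS =>
    ⟨SubtractionGame.SG_eq_limitWord hT hS, fun i n => ?_⟩,
    SubtractionGame.hasPositiveDensity_I, ?_, ?_⟩
  · rw [SubtractionGame.SG_truncation hT hS, SubtractionGame.rotationLetter_eq_limitWord_mod]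
  · rw [hI]
    exact SubtractionGame.range_limitWord
  · rw [hI]
    exact SubtractionGame.not_eventuallyPeriodic_limitWord
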